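/- Let $K$ be a field, let $s\ge 0$ and $d\ge 1$ be integers, and let $S=K[y_1,\dots,y_s]$ with $\deg y_i=1$ for all $i$. Let $$\mathcal A_d=\{a=(a_1,\dots,a_s)\in\mathbb N^s : a_1+\dots+a_s=d\}$$ be the $d$-th Veronese configuration, let $R=K[x_a : a\in\mathcal A_d]$, let $\phi:R\to S$ be the $K$-algebra homomorphism with $\phi(x_a)=y^a$, and let $P_{\mathcal A_d}=\ker\phi$. For a term order $\prec$, $\mathrm{in}_\prec(J)$ denotes the ideal generated by the initial terms of the elements of the ideal $J$. For a weight vector $w$ with entries in $\mathbb N$, the initial form $\mathrm{in}_w(f)$ of a polynomial $f$ is the sum of its terms of highest $w$-weight, and $\mathrm{in}_w(J)$ is the ideal generated by all $\mathrm{in}_w(f)$, $f\in J$. The term order $\prec_w$ compares monomials by their $w$-weight first and breaks ties by $\prec$. For a monomial ideal $J$, $\delta(J)$ denotes the maximum of the degrees of its minimal monomial generators ($\delta(0)=0$). **Theorem.** Let $I\subset S$ be a homogeneous ideal, let $w\in\mathbb N^s$ be a weight vector such that $\mathrm{in}_w(I)$ is a monomial ideal, and let $\prec$ be a term order on $R$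 such that $\mathrm{in}_\prec(P_{\mathcal A_d})$ is generated by square-free monomials of degree two. Let $w'$ be the weight vector on $R$ that gives $x_a$ the weight $w\cdot a$. Then: 1. $\delta\bigl(\mathrm{in}_{\prec_{w'}}(\phi^{-1}(I))\bigr)\le\max\{2,\ \delta(\mathrm{in}_w(I))\}$. 2. If $\mathrm{in}_w(I)$ is generated by square-free monomials, then $\mathrm{in}_{\prec_{w'}}(\phi^{-1}(I))$ is generated by square-free monomials. -/

import Mathlib

open MvPolynomial

noncomputable section

namespace Veronese

variable {σ τ : Type*} {K : Type*} [Field K]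

/-! ### Term orders refined by a weight vector -/

/-- The exponent vectors, to be ordered by weight first and by the term order `m` second. -/
def WeightSyn (_m : MonomialOrder σ) (_w : σ → ℕ) : Type _ := σ →₀ ℕ

namespace WeightSyn

variable (m : MonomialOrder σ) (w : σ → ℕ)

/-- The identity map to the synonym. -/
def mk (a : σ →₀ ℕ) : WeightSyn m w := a

/-- The identity map from the synonym. -/
def exps (a : WeightSyn m w) : σ →₀ ℕ := a

instance : AddCommMonoid (WeightSyn m w) := inferInstanceAs (AddCommMonoid (σ →₀ ℕ))

/-- The identity map to the synonym as an additive equivalence. -/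
def mkEquiv : (σ →₀ ℕ) ≃+ WeightSyn m w where
  toFun := mk m w
  invFun := exps m w
  left_inv _ := rfl
  right_inv _ := rfl
  map_add' _ _ := rfl

/-- The pair (weight, position in the term order), compared lexicographically. -/
def key (a : WeightSyn m w) : ℕ ×ₗ m.syn :=
  toLex (Finsupp.weight w (exps m w a), m.toSyn (exps m w a))

theorem key_injective : Function.Injective (key m w) := fun a b h => by
  have h2 : m.toSyn (exps m w a) = m.toSyn (exps m w b) := congrArg (fun p => (ofLex p).2) h
  exact m.toSyn.injective h2

theorem key_add (a b : WeightSyn m w) : key m w (a + b) = key m w a + key m w b := by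
  have h : exps m w (a + b) = exps m w a + exps m w b := rfl
  simp only [key, h, map_add]
  rfl

instance : LinearOrder (WeightSyn m w) := LinearOrder.lift' (key m w) (key_injective m w)

theorem le_iff_key (a b : WeightSyn m w) : a ≤ b ↔ key m w a ≤ key m w b := Iff.rfl

theorem lt_iff_key (a b : WeightSyn m w) : a < b ↔ key m w a < key m w b := Iff.rfl

instance : IsOrderedAddMonoid (WeightSyn m w) where
  add_le_add_left a b h c := by
    rw [le_iff_key] at h ⊢
    rw [key_add, key_add, Prod.Lex.le_iff] at *
    rcases h with h | ⟨h1, h2⟩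
    · exact Or.inl (by simpa using h)
    · exact Or.inr ⟨by simpa using h1, by simpa using h2⟩

instance : WellFoundedLT (WeightSyn m w) :=
  ⟨InvImage.wf (key m w) (wellFounded_lt (α := ℕ ×ₗ m.syn))⟩

end WeightSyn

/-- The term order `≺_w`: exponents are compared by their weight `w · a`, ties being broken by the
term order `m`. -/
def weightOrder (m : MonomialOrder σ) (w : σ → ℕ) : MonomialOrder σ where
  syn := WeightSyn m w
  toSyn := WeightSyn.mkEquiv m w
  toSyn_monotone := fun a b h => by
    change WeightSyn.key m w (WeightSyn.mk m w a) ≤ WeightSyn.key m w (WeightSyn.mk m w b)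
    obtain ⟨c, rfl⟩ := exists_add_of_le h
    rw [Prod.Lex.le_iff]
    have h1 : Finsupp.weight w a ≤ Finsupp.weight w (a + c) := by simp
    rcases h1.lt_or_eq with h1 | h1
    · exact Or.inl h1
    · exact Or.inr ⟨h1, m.toSyn_monotone h⟩

theorem weightOrder_lt_iff (m : MonomialOrder σ) (w : σ → ℕ) (a b : σ →₀ ℕ) :
    (weightOrder m w).toSyn a < (weightOrder m w).toSyn b ↔
      Finsupp.weight w a < Finsupp.weight w b ∨
        (Finsupp.weight w a = Finsupp.weight w b ∧ m.toSyn a < m.toSyn b) :=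
  Prod.Lex.lt_iff (x := WeightSyn.key m w (WeightSyn.mk m w a))
    (y := WeightSyn.key m w (WeightSyn.mk m w b))

/-! ### Homogeneous ideals and initial ideals -/

attribute [local instance] MvPolynomial.gradedAlgebra

/-- `I` is homogeneous for the standard grading, in which every variable has degree one. -/
def IsHomogeneousIdeal (I : Ideal (MvPolynomial σ K)) : Prop :=
  I.IsHomogeneous (homogeneousSubmodule σ K)

/-- The initial ideal of `I` with respect to the term order `m`, generated by the initial terms of
the elements of `I`. -/
def initialIdeal (m : MonomialOrder σ) (I : Ideal (MvPolynomial σ K)) :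
    Ideal (MvPolynomial σ K) :=
  Ideal.span (m.leadingTerm '' (I : Set (MvPolynomial σ K)))

/-- The initial form of `f` for the weight vector `w`: the sum of its terms of highest weight. -/
def initialForm (w : σ → ℕ) (f : MvPolynomial σ K) : MvPolynomial σ K :=
  weightedHomogeneousComponent w (weightedTotalDegree w f) f

/-- The initial ideal of `I` with respect to the weight vector `w`, generated by the initial forms
of the elements of `I`. -/
def weightInitialIdeal (w : σ → ℕ) (I : Ideal (MvPolynomial σ K)) : Ideal (MvPolynomial σ K) :=
  Ideal.span (initialForm w '' (I : Set (MvPolynomial σ K)))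

/-! ### Monomial ideals -/

/-- `J` is generated by monomials `x^a` whose exponents `a` all satisfy `P`. -/
def GeneratedByMonomials (P : (σ →₀ ℕ) → Prop) (J : Ideal (MvPolynomial σ K)) : Prop :=
  ∃ G : Set (σ →₀ ℕ), (∀ a ∈ G, P a) ∧ J = Ideal.span ((fun a => monomial a (1 : K)) '' G)

/-- `J` is a monomial ideal. -/
def IsMonomialIdeal (J : Ideal (MvPolynomial σ K)) : Prop :=
  GeneratedByMonomials (fun _ => True) J

/-- The monomial `x^a` is square-free. -/
def SquarefreeExponent (a : σ →₀ ℕ) : Prop := ∀ i, a i ≤ 1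

/-- `J` is generated by square-free monomials. -/
def IsSquarefreeIdeal (J : Ideal (MvPolynomial σ K)) : Prop :=
  GeneratedByMonomials SquarefreeExponent J

/-- `J` is generated by square-free monomials of degree two. -/
def IsSquarefreeQuadraticIdeal (J : Ideal (MvPolynomial σ K)) : Prop :=
  GeneratedByMonomials (fun a => SquarefreeExponent a ∧ a.degree = 2) J

/-- The exponents of the monomials in `J` that are minimal for divisibility. For a monomial ideal
they are the exponents of its minimal system of monomial generators. -/
def minimalExponents (J : Ideal (MvPolynomial σ K)) : Set (σ →₀ ℕ) :=
  {a | Minimal (fun b => monomial b (1 : K) ∈ J) a}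

theorem minimalExponents_finite [Finite σ] (J : Ideal (MvPolynomial σ K)) :
    (minimalExponents J).Finite := by
  have h : IsAntichain (· ≤ ·) (minimalExponents J) := setOfPred_minimal_antichain _
  exact h.finite_of_partiallyWellOrderedOn (Set.isPWO_of_wellQuasiOrderedLE _)

/-- A monomial ideal is generated by the monomials with exponents in `minimalExponents`. -/
theorem IsMonomialIdeal.eq_span_minimalExponents [Finite σ] {J : Ideal (MvPolynomial σ K)}
    (hJ : IsMonomialIdeal J) :
    J = Ideal.span ((fun a => monomial a (1 : K)) '' minimalExponents J) := by
  obtain ⟨G, -, hG⟩ := hJ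
  apply le_antisymm
  · conv_lhs => rw [hG]
    rw [Ideal.span_le]
    rintro _ ⟨a, ha, rfl⟩
    have haJ : monomial a (1 : K) ∈ J := hG ▸ Ideal.subset_span ⟨a, ha, rfl⟩
    obtain ⟨b, hba, hb⟩ := exists_minimal_le_of_wellFoundedLT
      (fun b => monomial b (1 : K) ∈ J) a haJ
    refine mem_ideal_span_monomial_image.2 fun x hx => ⟨b, hb, ?_⟩
    have hxa : x = a := by simpa using support_monomial_subset hx
    exact hxa ▸ hba
  · rw [Ideal.span_le]
    rintro _ ⟨a, ha, rfl⟩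
    exact (show Minimal (fun b => monomial b (1 : K) ∈ J) a from ha).prop

/-- `δ(J)`: the maximum of the degrees of the minimal monomial generators of `J`
(`0` for the zero ideal, which has none). -/
def delta [Finite σ] (J : Ideal (MvPolynomial σ K)) : ℕ :=
  (minimalExponents_finite J).toFinset.sup fun a => a.degree

/-! ### Monomial homomorphisms and Veronese configurations -/

/-- The monomial homomorphism `x_j ↦ y^(A j)`. -/
def monomialHom (K : Type*) [Field K] (A : τ → σ →₀ ℕ) :
    MvPolynomial τ K →ₐ[K] MvPolynomial σ K :=
  aeval fun j => monomial (A j) (1 : K)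

/-- The toric ideal of `A`, the kernel of the monomial homomorphism. -/
def toricIdeal (K : Type*) [Field K] (A : τ → σ →₀ ℕ) : Ideal (MvPolynomial τ K) :=
  RingHom.ker (monomialHom K A)

/-- The contraction of `I` under the monomial homomorphism of `A`. -/
def contraction (A : τ → σ →₀ ℕ) (I : Ideal (MvPolynomial σ K)) : Ideal (MvPolynomial τ K) :=
  I.comap (monomialHom K A)

/-- The pulled back weight vector `w · A`; its entry at `j` is the weight of `y^(A j)`. -/
def pullbackWeight (A : τ → σ →₀ ℕ) (w : σ → ℕ) : τ → ℕ :=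
  fun j => Finsupp.weight w (A j)

/-- The `d`-th Veronese configuration: all exponent vectors in `s` variables of degree `d`. -/
abbrev Config (s d : ℕ) : Type := {a : Fin s →₀ ℕ // a.degree = d}

instance (s d : ℕ) : Finite (Config s d) :=
  Set.Finite.to_subtype ((Finsupp.finite_of_degree_le d).subset fun _ h => le_of_eq h)

/-- The Veronese configuration as a family of exponent vectors, indexed by itself. -/
def config (s d : ℕ) : Config s d → Fin s →₀ ℕ := Subtype.val

end Veronese

end

open MvPolynomial
noncomputable section
namespace Veronese
attribute [local instance] MvPolynomial.gradedAlgebra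

variable {σ τ : Type*} {K : Type*} [Field K]

/-! ### Monomial ideals -/

/-! Membership in the initial ideal of the contraction is decided inside the fibres of `A` on
exponents. A monomial lies outside the initial ideal of the toric ideal exactly when it is the
smallest in its fibre, and the pulled-back weight is constant on fibres, so refining by it does not
change this notion. If `x^u` is not smallest in its fibre, a quadratic square-free generator of the
toric initial ideal divides it and already lies in the larger initial ideal; if `u` is a minimal
generator, it equals that quadric (`squarefree_quadratic_of_mem_minimalExponents`). If `x^u` is
smallest, it lies in the initial ideal iff its image lies in `in_w(I)`
(`IsFibreMinimal.monomial_imageExponent_mem` and `monomial_mem_initialIdeal_contraction`). A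
generator `y^b` of `in_w(I)` dividing the image is covered by at most `|b|` of the factors of `x^u`,
which bounds the degree of a minimal `u`. If `b` is square-free, a repeated factor is superfluous.
-/

theorem IsMonomialIdeal.monomial_mem {J : Ideal (MvPolynomial σ K)} (hJ : IsMonomialIdeal J)
    {f : MvPolynomial σ K} (hf : f ∈ J) {a : σ →₀ ℕ} (ha : a ∈ f.support) :
    monomial a (1 : K) ∈ J := by
  obtain ⟨G, -, rfl⟩ := hJ
  obtain ⟨b, hb, hba⟩ := mem_ideal_span_monomial_image.1 hf a ha
  refine mem_ideal_span_monomial_image.2 fun x hx => ⟨b, hb, ?_⟩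
  have hxa : x = a := by simpa using support_monomial_subset hx
  exact hxa ▸ hba

theorem monomial_mem_span_iff {G : Set (σ →₀ ℕ)} {a : σ →₀ ℕ} :
    monomial a (1 : K) ∈ Ideal.span ((fun b => monomial b (1 : K)) '' G) ↔ ∃ b ∈ G, b ≤ a := by
  classical
  rw [mem_ideal_span_monomial_image, support_monomial, if_neg one_ne_zero]
  simp only [Finset.mem_singleton, forall_eq]

theorem monomial_mem_of_le {J : Ideal (MvPolynomial σ K)} {a b : σ →₀ ℕ} (hab : a ≤ b)
    (ha : monomial a (1 : K) ∈ J) : monomial b (1 : K) ∈ J := by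
  obtain ⟨c, rfl⟩ := exists_add_of_le hab
  have h := J.mul_mem_left (monomial c (1 : K)) ha
  rwa [monomial_mul, one_mul, add_comm] at h

theorem degree_le_delta [Finite σ] {J : Ideal (MvPolynomial σ K)} {a : σ →₀ ℕ}
    (ha : a ∈ minimalExponents J) : a.degree ≤ delta J :=
  Finset.le_sup (f := fun a : σ →₀ ℕ => a.degree)
    ((minimalExponents_finite J).mem_toFinset.2 ha)

theorem delta_le_iff [Finite σ] {J : Ideal (MvPolynomial σ K)} {n : ℕ} :
    delta J ≤ n ↔ ∀ a ∈ minimalExponents J, a.degree ≤ n := by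
  simp [delta]

theorem exists_minimalExponents_le {J : Ideal (MvPolynomial σ K)} {a : σ →₀ ℕ}
    (ha : monomial a (1 : K) ∈ J) : ∃ b ∈ minimalExponents J, b ≤ a := by
  obtain ⟨b, hba, hb⟩ := exists_minimal_le_of_wellFoundedLT
    (fun b => monomial b (1 : K) ∈ J) a ha
  exact ⟨b, hb, hba⟩

theorem IsMonomialIdeal.isSquarefreeIdeal [Finite σ] {J : Ideal (MvPolynomial σ K)}
    (hJ : IsMonomialIdeal J) (h : ∀ a ∈ minimalExponents J, SquarefreeExponent a) :
    IsSquarefreeIdeal J :=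
  ⟨_, h, hJ.eq_span_minimalExponents⟩

/-! ### Initial ideals -/

theorem initialIdeal_eq_span_monomial (m : MonomialOrder σ) (I : Ideal (MvPolynomial σ K)) :
    initialIdeal m I =
      Ideal.span ((fun a => monomial a (1 : K)) '' {a | ∃ f ∈ I, f ≠ 0 ∧ m.degree f = a}) := by
  rw [initialIdeal, MonomialOrder.span_leadingTerm_eq_span_monomial']
  congr 1
  ext p
  simp only [Set.mem_image, Set.mem_sdiff, Set.mem_ofPred_eq, SetLike.mem_coe,
    Set.mem_singleton_iff]
  constructor
  · rintro ⟨f, ⟨hf, hf0⟩, rfl⟩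
    exact ⟨_, ⟨f, hf, hf0, rfl⟩, rfl⟩
  · rintro ⟨_, ⟨f, hf, hf0, rfl⟩, rfl⟩
    exact ⟨f, ⟨hf, hf0⟩, rfl⟩

theorem isMonomialIdeal_initialIdeal (m : MonomialOrder σ) (I : Ideal (MvPolynomial σ K)) :
    IsMonomialIdeal (initialIdeal m I) :=
  ⟨_, fun _ _ => trivial, initialIdeal_eq_span_monomial m I⟩

/-- Multiplying by monomials shows that the leading exponents of nonzero elements are already closed
upwards. -/
theorem monomial_mem_initialIdeal_iff {m : MonomialOrder σ} {I : Ideal (MvPolynomial σ K)}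
    {a : σ →₀ ℕ} :
    monomial a (1 : K) ∈ initialIdeal m I ↔ ∃ f ∈ I, f ≠ 0 ∧ m.degree f = a := by
  classical
  rw [initialIdeal_eq_span_monomial, monomial_mem_span_iff]
  constructor
  · rintro ⟨_, ⟨f, hf, hf0, rfl⟩, hle⟩
    obtain ⟨c, rfl⟩ := exists_add_of_le hle
    have hc : monomial c (1 : K) ≠ 0 := by simp
    refine ⟨monomial c 1 * f, I.mul_mem_left _ hf, mul_ne_zero hc hf0, ?_⟩
    rw [m.degree_mul hc hf0, m.degree_monomial, if_neg one_ne_zero, add_comm]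
  · exact fun h => ⟨a, h, le_rfl⟩

/-- An element whose unique highest exponent is `a` shows that `x^a` lies in the initial ideal. -/
theorem monomial_mem_initialIdeal {m : MonomialOrder σ} {I : Ideal (MvPolynomial σ K)}
    {f : MvPolynomial σ K} (hf : f ∈ I) {a : σ →₀ ℕ} (ha : coeff a f ≠ 0)
    (h : ∀ b ∈ f.support, b ≠ a → m.toSyn b < m.toSyn a) :
    monomial a (1 : K) ∈ initialIdeal m I := by
  have ha' : a ∈ f.support := mem_support_iff.2 ha
  have hf0 : f ≠ 0 := by rintro rfl; simp at ha
  refine monomial_mem_initialIdeal_iff.2 ⟨f, hf, hf0, ?_⟩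
  by_contra hne
  exact (h _ (m.degree_mem_support hf0) hne).not_ge (m.le_degree ha')

theorem coeff_initialForm (w : σ → ℕ) (f : MvPolynomial σ K) (a : σ →₀ ℕ) :
    coeff a (initialForm w f) =
      if Finsupp.weight w a = weightedTotalDegree w f then coeff a f else 0 :=
  coeff_weightedHomogeneousComponent _ _ _

/-- The weighted homogeneous components of the elements of `in_w(I)` are the top components of
elements of `I`. -/
theorem exists_mem_of_mem_weightInitialIdeal {w : σ → ℕ} {I : Ideal (MvPolynomial σ K)}
    {p : MvPolynomial σ K} (hp : p ∈ weightInitialIdeal w I) (n : ℕ) :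
    ∃ g ∈ I, (∀ c, Finsupp.weight w c = n → coeff c g = coeff c p) ∧
      ∀ c, n < Finsupp.weight w c → coeff c g = 0 := by
  classical
  induction hp using Submodule.span_induction generalizing n with
  | mem p hp =>
    obtain ⟨f, hf, rfl⟩ := hp
    by_cases hn : n = weightedTotalDegree w f
    · refine ⟨f, hf, fun c hc => ?_, fun c hc => ?_⟩
      · rw [coeff_initialForm, if_pos (hc.trans hn)]
      · by_contra h0
        have := le_weightedTotalDegree w (mem_support_iff.2 h0)
        omega
    · refine ⟨0, I.zero_mem, fun c hc => ?_, fun c _ => coeff_zero c⟩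
      rw [coeff_initialForm, if_neg (hc.trans_ne hn), coeff_zero]
  | zero => exact ⟨0, I.zero_mem, fun c _ => rfl, fun c _ => coeff_zero c⟩
  | add p q _ _ hp hq =>
    obtain ⟨g, hg, h1, h2⟩ := hp n
    obtain ⟨g', hg', h1', h2'⟩ := hq n
    refine ⟨g + g', I.add_mem hg hg', fun c hc => ?_, fun c hc => ?_⟩
    · rw [coeff_add, coeff_add, h1 c hc, h1' c hc]
    · rw [coeff_add, h2 c hc, h2' c hc, add_zero]
  | smul a p _ hp =>
    induction a using MvPolynomial.induction_on' generalizing n with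
    | monomial e r =>
      have hsub {c : σ →₀ ℕ} (hec : e ≤ c) :
          Finsupp.weight w c = Finsupp.weight w e + Finsupp.weight w (c - e) := by
        rw [← map_add, add_tsub_cancel_of_le hec]
      -- Multiplication by `x^e` shifts weights by that of `e`, so the component of weight `n` comes
      -- from weight `n - weight e` of `p`, and is zero if `e` is too heavy.
      by_cases hen : Finsupp.weight w e ≤ n
      · obtain ⟨g, hg, h1, h2⟩ := hp (n - Finsupp.weight w e)
        refine ⟨monomial e r * g, I.mul_mem_left _ hg, fun c hc => ?_, fun c hc => ?_⟩
        · rw [smul_eq_mul, coeff_monomial_mul', coeff_monomial_mul']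
          split_ifs with hec
          · rw [h1]
            have := hsub hec
            omega
          · rfl
        · rw [coeff_monomial_mul']
          split_ifs with hec
          · rw [h2, mul_zero]
            have := hsub hec
            omega
          · rfl
      · refine ⟨0, I.zero_mem, fun c hc => ?_, fun c _ => coeff_zero c⟩
        rw [smul_eq_mul, coeff_monomial_mul', coeff_zero, if_neg]
        intro hec
        have := hsub hec
        omega
    | add a b ha hb =>
      obtain ⟨g, hg, h1, h2⟩ := ha n
      obtain ⟨g', hg', h1', h2'⟩ := hb n
      refine ⟨g + g', I.add_mem hg hg', fun c hc => ?_, fun c hc => ?_⟩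
      · rw [coeff_add, add_smul, coeff_add, h1 c hc, h1' c hc]
      · rw [coeff_add, h2 c hc, h2' c hc, add_zero]

/-- A monomial of `in_w(I)` is the initial form of a homogeneous element of `I`. -/
theorem IsHomogeneousIdeal.exists_isHomogeneous {w : σ → ℕ} {I : Ideal (MvPolynomial σ K)}
    (hI : IsHomogeneousIdeal I) {b : σ →₀ ℕ}
    (hb : monomial b (1 : K) ∈ weightInitialIdeal w I) :
    ∃ g ∈ I, g.IsHomogeneous b.degree ∧ coeff b g = 1 ∧
      ∀ c ∈ g.support, c ≠ b → Finsupp.weight w c < Finsupp.weight w b := by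
  classical
  obtain ⟨g, hg, h1, h2⟩ := exists_mem_of_mem_weightInitialIdeal hb (Finsupp.weight w b)
  -- Passing to the component of degree `|b|` keeps the term at `b` and only deletes others.
  refine ⟨_, homogeneousComponent_mem_of_mem hI hg b.degree,
    homogeneousComponent_isHomogeneous _ _, ?_, fun c hc hcb => ?_⟩
  · rw [coeff_homogeneousComponent, if_pos rfl, h1 b rfl, coeff_monomial, if_pos rfl]
  · have hc' : coeff c g ≠ 0 := by
      rw [mem_support_iff, coeff_homogeneousComponent] at hc
      exact fun h => hc (by simp [h])
    by_contra hlt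
    rcases (not_lt.1 hlt).lt_or_eq with h | h
    · exact hc' (h2 c h)
    · exact hc' (by rw [h1 c h.symm, coeff_monomial, if_neg hcb.symm])

/-! ### Fibres of a monomial homomorphism -/

/-- The exponent `∑ u_j A_j` of the image of `x^u` under the monomial homomorphism of `A`. -/
def imageExponent (A : τ → σ →₀ ℕ) (u : τ →₀ ℕ) : σ →₀ ℕ :=
  Finsupp.linearCombination ℕ A u

theorem imageExponent_add (A : τ → σ →₀ ℕ) (u v : τ →₀ ℕ) :
    imageExponent A (u + v) = imageExponent A u + imageExponent A v :=
  map_add _ u v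

theorem imageExponent_single (A : τ → σ →₀ ℕ) (j : τ) (n : ℕ) :
    imageExponent A (Finsupp.single j n) = n • A j :=
  Finsupp.linearCombination_single ℕ n j

theorem monomialHom_monomial (A : τ → σ →₀ ℕ) (u : τ →₀ ℕ) (c : K) :
    monomialHom K A (monomial u c) = monomial (imageExponent A u) c := by
  classical
  rw [monomialHom, aeval_monomial, imageExponent, Finsupp.linearCombination_apply,
    MvPolynomial.algebraMap_eq]
  simp only [monomial_pow, one_pow, Finsupp.prod, Finsupp.sum]
  rw [← monomial_sum_one, C_mul_monomial, mul_one]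

theorem weight_pullbackWeight (A : τ → σ →₀ ℕ) (w : σ → ℕ) (u : τ →₀ ℕ) :
    Finsupp.weight (pullbackWeight A w) u = Finsupp.weight w (imageExponent A u) := by
  induction u using Finsupp.induction_linear with
  | zero => simp [imageExponent]
  | add f g hf hg => rw [map_add, hf, hg, imageExponent_add, map_add]
  | single j n => simp [imageExponent_single, Finsupp.weight_single, pullbackWeight]

theorem coeff_monomialHom [DecidableEq σ] (A : τ → σ →₀ ℕ) (f : MvPolynomial τ K)
    (b : σ →₀ ℕ) :
    coeff b (monomialHom K A f) =
      ∑ v ∈ f.support, if imageExponent A v = b then coeff v f else 0 := by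
  conv_lhs => rw [f.as_sum]
  rw [map_sum, coeff_sum]
  refine Finset.sum_congr rfl fun v _ => ?_
  rw [monomialHom_monomial, coeff_monomial]

theorem exists_of_mem_support_monomialHom {A : τ → σ →₀ ℕ} {f : MvPolynomial τ K} {b : σ →₀ ℕ}
    (hb : b ∈ (monomialHom K A f).support) : ∃ v ∈ f.support, imageExponent A v = b := by
  classical
  rw [mem_support_iff, coeff_monomialHom] at hb
  obtain ⟨v, hv, h⟩ := Finset.exists_ne_zero_of_sum_ne_zero hb
  exact ⟨v, hv, by_contra fun hne => h (if_neg hne)⟩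

/-- `x^u` is the smallest monomial in its fibre. -/
def IsFibreMinimal (m : MonomialOrder τ) (A : τ → σ →₀ ℕ) (u : τ →₀ ℕ) : Prop :=
  ∀ v, imageExponent A v = imageExponent A u → m.toSyn u ≤ m.toSyn v

/-- The leading coefficient survives in the image when the leading monomial is the smallest one
of its fibre. -/
theorem IsFibreMinimal.coeff_monomialHom {m : MonomialOrder τ} {A : τ → σ →₀ ℕ} {u : τ →₀ ℕ}
    (hu : IsFibreMinimal m A u) {f : MvPolynomial τ K} (hfu : u ∈ f.support)
    (h : ∀ v ∈ f.support, imageExponent A v = imageExponent A u → m.toSyn v ≤ m.toSyn u) :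
    coeff (imageExponent A u) (monomialHom K A f) = coeff u f := by
  classical
  rw [Veronese.coeff_monomialHom, Finset.sum_eq_single_of_mem u hfu, if_pos rfl]
  intro v hv hvu
  refine if_neg fun hA => hvu (m.toSyn.injective ((h v hv hA).antisymm (hu v hA)))

theorem monomial_sub_monomial_mem_toricIdeal {A : τ → σ →₀ ℕ} {u v : τ →₀ ℕ}
    (h : imageExponent A v = imageExponent A u) :
    monomial u (1 : K) - monomial v 1 ∈ toricIdeal K A := by
  rw [toricIdeal, RingHom.mem_ker, map_sub, monomialHom_monomial, monomialHom_monomial, h,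
    sub_self]

theorem monomial_mem_initialIdeal_of_lt {m : MonomialOrder τ} {A : τ → σ →₀ ℕ}
    {J : Ideal (MvPolynomial τ K)} (hJ : toricIdeal K A ≤ J) {u v : τ →₀ ℕ}
    (h : imageExponent A v = imageExponent A u) (hvu : m.toSyn v < m.toSyn u) :
    monomial u (1 : K) ∈ initialIdeal m J := by
  classical
  have hne : v ≠ u := by rintro rfl; exact hvu.false
  refine monomial_mem_initialIdeal (hJ (monomial_sub_monomial_mem_toricIdeal h)) ?_ ?_
  · simp [coeff_monomial, hne]
  · intro b hb hbu
    have : b = v := by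
      by_contra hbv
      exact mem_support_iff.1 hb (by simp [coeff_monomial, Ne.symm hbu, Ne.symm hbv])
    rwa [this]

/-- A fibre-minimal leading term would survive in the image of `f`, which is zero. Conversely, two
monomials of one fibre differ by an element of the toric ideal. -/
theorem monomial_mem_initialIdeal_toricIdeal_iff {m : MonomialOrder τ} {A : τ → σ →₀ ℕ}
    {u : τ →₀ ℕ} :
    monomial u (1 : K) ∈ initialIdeal m (toricIdeal K A) ↔ ¬ IsFibreMinimal m A u := by
  constructor
  · intro h hu
    obtain ⟨f, hf, hf0, rfl⟩ := monomial_mem_initialIdeal_iff.1 h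
    have h1 := hu.coeff_monomialHom (m.degree_mem_support hf0) fun v hv _ => m.le_degree hv
    rw [RingHom.mem_ker.1 hf, coeff_zero] at h1
    exact m.coeff_degree_ne_zero_iff.2 hf0 h1.symm
  · intro h
    simp only [IsFibreMinimal, not_forall, not_le] at h
    obtain ⟨v, hA, hvu⟩ := h
    exact monomial_mem_initialIdeal_of_lt le_rfl hA hvu

theorem isFibreMinimal_weightOrder_iff {m : MonomialOrder τ} {A : τ → σ →₀ ℕ} {w : σ → ℕ}
    {u : τ →₀ ℕ} :
    IsFibreMinimal (weightOrder m (pullbackWeight A w)) A u ↔ IsFibreMinimal m A u := by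
  refine forall₂_congr fun v hA => ?_
  rw [← not_lt, ← not_lt, weightOrder_lt_iff, weight_pullbackWeight, weight_pullbackWeight, hA]
  simp

theorem toricIdeal_le_contraction (A : τ → σ →₀ ℕ) (I : Ideal (MvPolynomial σ K)) :
    toricIdeal K A ≤ contraction A I :=
  Ideal.comap_mono bot_le

theorem monomial_mem_initialIdeal_contraction_of_not_isFibreMinimal {m : MonomialOrder τ}
    {A : τ → σ →₀ ℕ} {w : σ → ℕ} {I : Ideal (MvPolynomial σ K)} {u : τ →₀ ℕ}
    (hu : ¬ IsFibreMinimal m A u) :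
    monomial u (1 : K) ∈ initialIdeal (weightOrder m (pullbackWeight A w)) (contraction A I) := by
  rw [← isFibreMinimal_weightOrder_iff (w := w)] at hu
  simp only [IsFibreMinimal, not_forall, not_le] at hu
  obtain ⟨v, hA, hvu⟩ := hu
  exact monomial_mem_initialIdeal_of_lt (toricIdeal_le_contraction A I) hA hvu

/-- The leading term of `f` survives in its image and has top weight there, because the homomorphism
preserves weights. It is thus a term of the initial form, and a monomial ideal contains the terms of
its elements. -/
theorem IsFibreMinimal.monomial_imageExponent_mem {m : MonomialOrder τ} {A : τ → σ →₀ ℕ}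
    {w : σ → ℕ} {I : Ideal (MvPolynomial σ K)} (hw : IsMonomialIdeal (weightInitialIdeal w I))
    {u : τ →₀ ℕ} (hu : IsFibreMinimal m A u)
    (h : monomial u (1 : K) ∈
      initialIdeal (weightOrder m (pullbackWeight A w)) (contraction A I)) :
    monomial (imageExponent A u) (1 : K) ∈ weightInitialIdeal w I := by
  classical
  rw [← isFibreMinimal_weightOrder_iff (w := w)] at hu
  obtain ⟨f, hf, hf0, rfl⟩ := monomial_mem_initialIdeal_iff.1 h
  set m' := weightOrder m (pullbackWeight A w) with hm'
  have hcoeff := hu.coeff_monomialHom (m'.degree_mem_support hf0) fun v hv _ => m'.le_degree hv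
  have hne : coeff (imageExponent A (m'.degree f)) (monomialHom K A f) ≠ 0 := by
    rw [hcoeff]
    exact m'.coeff_degree_ne_zero_iff.2 hf0
  have htop : Finsupp.weight w (imageExponent A (m'.degree f)) =
      weightedTotalDegree w (monomialHom K A f) := by
    refine (le_weightedTotalDegree w (mem_support_iff.2 hne)).antisymm (Finset.sup_le ?_)
    intro c hc
    obtain ⟨v, hv, rfl⟩ := exists_of_mem_support_monomialHom hc
    have h1 := m'.le_degree hv
    rw [← not_lt, hm', weightOrder_lt_iff, weight_pullbackWeight, weight_pullbackWeight] at h1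
    by_contra h2
    exact h1 (Or.inl (not_le.1 h2))
  refine hw.monomial_mem (Ideal.subset_span ⟨monomialHom K A f, hf, rfl⟩) ?_
  rw [mem_support_iff, coeff_initialForm, if_pos htop]
  exact hne

/-- Below `u` a vector of size at most `|b|` suffices to cover `b`. -/
theorem exists_le_imageExponent (A : τ → σ →₀ ℕ) (u : τ →₀ ℕ) (b : σ →₀ ℕ)
    (hb : b ≤ imageExponent A u) :
    ∃ v ≤ u, v.degree ≤ b.degree ∧ b ≤ imageExponent A v := by
  classical
  induction hn : b.degree generalizing b with
  | zero =>
    rw [Finsupp.degree_eq_zero_iff] at hn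
    exact ⟨0, zero_le, by simp, by simp [hn]⟩
  | succ n ih =>
    obtain ⟨c, hcb, hc⟩ := b.exists_le_degree_eq n (by omega)
    obtain ⟨e, rfl⟩ := exists_add_of_le hcb
    obtain ⟨v, hvu, hv, hcv⟩ := ih c (hcb.trans hb) hc
    have he : e.degree = 1 := by rw [map_add] at hn; omega
    obtain ⟨i, rfl⟩ : ∃ i, e = Finsupp.single i 1 := (Finsupp.sum_eq_one_iff e).1 he
    by_cases hle : c + Finsupp.single i 1 ≤ imageExponent A v
    · exact ⟨v, hvu, by omega, hle⟩
    -- Now `v` covers `c` but lacks one `y_i`; since `u` covers `b`, the rest `r` has a factor `x_j`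
    -- whose image involves `y_i`.
    obtain ⟨r, rfl⟩ := exists_add_of_le hvu
    have hi : imageExponent A v i < c i + 1 := by
      by_contra h
      refine hle fun k => ?_
      by_cases hk : k = i
      · subst hk; simpa using h
      · simpa [Finsupp.single_apply, Ne.symm hk] using hcv k
    have hr : imageExponent A r i ≠ 0 := by
      have := hb i
      simp only [imageExponent_add, Finsupp.add_apply, Finsupp.single_eq_same] at this
      omega
    obtain ⟨j, hj, hji⟩ : ∃ j ∈ r.support, A j i ≠ 0 := by
      rw [imageExponent, Finsupp.linearCombination_apply, Finsupp.sum, Finsupp.finsetSum_apply]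
        at hr
      obtain ⟨j, hj, h⟩ := Finset.exists_ne_zero_of_sum_ne_zero hr
      exact ⟨j, hj, fun h0 => h (by simp [h0])⟩
    have hjr : Finsupp.single j 1 ≤ r := by
      rw [Finsupp.single_le_iff]
      exact Nat.one_le_iff_ne_zero.2 (Finsupp.mem_support_iff.1 hj)
    refine ⟨v + Finsupp.single j 1, add_le_add_right hjr v, ?_, ?_⟩
    · rw [map_add, Finsupp.degree_single]; omega
    · rw [imageExponent_add, imageExponent_single, one_smul]
      refine add_le_add hcv ?_
      rw [Finsupp.single_le_iff]
      exact Nat.one_le_iff_ne_zero.2 hji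

/-- A square-free vector that is covered by `v + 2 e_j` is covered by `v + e_j`. -/
theorem SquarefreeExponent.le_imageExponent {A : τ → σ →₀ ℕ} {b : σ →₀ ℕ}
    (hb : SquarefreeExponent b) {v : τ →₀ ℕ} {j : τ}
    (h : b ≤ imageExponent A (v + Finsupp.single j 2)) :
    b ≤ imageExponent A (v + Finsupp.single j 1) := by
  intro i
  have h1 := h i
  have h2 := hb i
  simp only [imageExponent_add, imageExponent_single, Finsupp.add_apply, Finsupp.smul_apply,
    smul_eq_mul] at h1 ⊢
  omega

/-! ### Veronese configurations -/

theorem degree_imageExponent_config {s d : ℕ} (u : Config s d →₀ ℕ) :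
    (imageExponent (config s d) u).degree = d * u.degree := by
  induction u using Finsupp.induction_linear with
  | zero => simp [imageExponent]
  | add f g hf hg => rw [imageExponent_add, map_add, hf, hg, map_add, mul_add]
  | single j n =>
    rw [imageExponent_single, map_nsmul, Finsupp.degree_single, config, j.2, smul_eq_mul,
      mul_comm]

/-- The fullness of the Veronese configuration enters here: degree-`d` factors can be split off one
at a time. -/
theorem exists_imageExponent_config_eq {s d k : ℕ} (c : Fin s →₀ ℕ) (hc : c.degree = d * k) :
    ∃ v, imageExponent (config s d) v = c := by
  induction k generalizing c with
  | zero =>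
    rw [mul_zero, Finsupp.degree_eq_zero_iff] at hc
    exact ⟨0, by simp [imageExponent, hc]⟩
  | succ k ih =>
    rw [mul_add_one] at hc
    obtain ⟨a, hac, ha⟩ := c.exists_le_degree_eq d (by omega)
    obtain ⟨e, rfl⟩ := exists_add_of_le hac
    rw [map_add] at hc
    obtain ⟨v, rfl⟩ := ih e (by omega)
    refine ⟨Finsupp.single ⟨a, ha⟩ 1 + v, ?_⟩
    rw [imageExponent_add, imageExponent_single, one_smul, config]

/-- Each term of a homogeneous `g` with initial form the image of `x^u` has degree `d * |u|`, hence
lifts. Any lift sending the top term to `x^u` works, so `u` need not be fibre-minimal. -/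
theorem monomial_mem_initialIdeal_contraction {s d : ℕ} {I : Ideal (MvPolynomial (Fin s) K)}
    (hI : IsHomogeneousIdeal I) {w : Fin s → ℕ} {m : MonomialOrder (Config s d)}
    {u : Config s d →₀ ℕ}
    (hu : monomial (imageExponent (config s d) u) (1 : K) ∈ weightInitialIdeal w I) :
    monomial u (1 : K) ∈ initialIdeal (weightOrder m (pullbackWeight (config s d) w))
      (contraction (config s d) I) := by
  classical
  obtain ⟨g, hg, hhom, hgu, hlt⟩ := hI.exists_isHomogeneous hu
  have hex (c : Fin s →₀ ℕ) : ∃ v, (c ∈ g.support → imageExponent (config s d) v = c) ∧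
      (c = imageExponent (config s d) u → v = u) := by
    by_cases hcu : c = imageExponent (config s d) u
    · exact ⟨u, fun _ => hcu.symm, fun _ => rfl⟩
    by_cases hc : c ∈ g.support
    · have hdeg : c.degree = d * u.degree := by
        rw [← degree_imageExponent_config, ← hhom (mem_support_iff.1 hc),
          Finsupp.degree_eq_weight_one]
        rfl
      obtain ⟨v, hv⟩ := exists_imageExponent_config_eq c hdeg
      exact ⟨v, fun _ => hv, fun h => absurd h hcu⟩
    · exact ⟨0, fun h => absurd h hc, fun h => absurd h hcu⟩
  choose v hv hvu using hex
  have hvu' := hvu _ rfl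
  set b := imageExponent (config s d) u with hb
  have hbg : b ∈ g.support := by simp [hgu]
  set f : MvPolynomial (Config s d) K := ∑ c ∈ g.support, monomial (v c) (coeff c g) with hf
  have hfg : monomialHom K (config s d) f = g := by
    rw [hf, map_sum]
    conv_rhs => rw [g.as_sum]
    exact Finset.sum_congr rfl fun c hc => by rw [monomialHom_monomial, hv c hc]
  -- Distinct terms of `g` have distinct lifts, so no coefficients merge in `f`.
  have hinj {c c' : Fin s →₀ ℕ} (hc : c ∈ g.support) (hc' : c' ∈ g.support) (h : v c = v c') :
      c = c' := by rw [← hv c hc, h, hv c' hc']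
  refine monomial_mem_initialIdeal (f := f) ?_ ?_ ?_
  · rw [contraction, Ideal.mem_comap]
    exact hfg.symm ▸ hg
  · rw [hf, coeff_sum, Finset.sum_eq_single_of_mem b hbg, coeff_monomial, if_pos hvu', hgu]
    · exact one_ne_zero
    · intro c hc hcb
      rw [coeff_monomial, if_neg]
      exact fun h => hcb (hinj hc hbg (h.trans hvu'.symm))
  · intro x hx hxu
    obtain ⟨c, hc, hxc⟩ : ∃ c ∈ g.support, v c = x := by
      rw [mem_support_iff, hf, coeff_sum] at hx
      obtain ⟨c, hc, h⟩ := Finset.exists_ne_zero_of_sum_ne_zero hx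
      refine ⟨c, hc, by_contra fun hne => h ?_⟩
      rw [coeff_monomial, if_neg hne]
    subst hxc
    rw [weightOrder_lt_iff, weight_pullbackWeight, weight_pullbackWeight, hv c hc]
    exact Or.inl (hlt c hc fun h => hxu (hvu c h))

/-- A minimal generator of the initial ideal of the contraction that is not the smallest monomial
in its fibre is a square-free quadratic generator of the initial ideal of the toric ideal. -/
theorem squarefree_quadratic_of_mem_minimalExponents {A : τ → σ →₀ ℕ} {m : MonomialOrder τ}
    (hm : IsSquarefreeQuadraticIdeal (initialIdeal m (toricIdeal K A))) {w : σ → ℕ}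
    {I : Ideal (MvPolynomial σ K)} {u : τ →₀ ℕ}
    (hu : u ∈ minimalExponents
      (initialIdeal (weightOrder m (pullbackWeight A w)) (contraction A I)))
    (hmin : ¬ IsFibreMinimal m A u) : SquarefreeExponent u ∧ u.degree = 2 := by
  obtain ⟨G, hG, hspan⟩ := hm
  have hmem := (monomial_mem_initialIdeal_toricIdeal_iff (K := K)).2 hmin
  rw [hspan, monomial_mem_span_iff] at hmem
  obtain ⟨q, hq, hqu⟩ := hmem
  have hqmin : ¬ IsFibreMinimal m A q := by
    rw [← monomial_mem_initialIdeal_toricIdeal_iff (K := K), hspan, monomial_mem_span_iff]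
    exact ⟨q, hq, le_rfl⟩
  -- The divisor `q` is itself in the initial ideal of the contraction, so minimality of `u` forces
  -- equality.
  have huq : u ≤ q :=
    hu.2 (monomial_mem_initialIdeal_contraction_of_not_isFibreMinimal hqmin) hqu
  exact hqu.antisymm huq ▸ hG q hq

end Veronese
end

theorem mainTheorem10 {K : Type*} [Field K] (s d : ℕ) (hd : 0 < d)
    (I : Ideal (MvPolynomial (Fin s) K))
    (hI : Veronese.IsHomogeneousIdeal I)
    (w : Fin s → ℕ) (hw : Veronese.IsMonomialIdeal (Veronese.weightInitialIdeal w I))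
    (m : MonomialOrder (Veronese.Config s d))
    (hm : Veronese.IsSquarefreeQuadraticIdeal
      (Veronese.initialIdeal m (Veronese.toricIdeal K (Veronese.config s d)))) :
    Veronese.delta
        (Veronese.initialIdeal
          (Veronese.weightOrder m (Veronese.pullbackWeight (Veronese.config s d) w))
          (Veronese.contraction (Veronese.config s d) I))
      ≤ max 2 (Veronese.delta (Veronese.weightInitialIdeal w I)) ∧
    (Veronese.IsSquarefreeIdeal (Veronese.weightInitialIdeal w I) →
      Veronese.IsSquarefreeIdeal
        (Veronese.initialIdeal
          (Veronese.weightOrder m (Veronese.pullbackWeight (Veronese.config s d) w))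
          (Veronese.contraction (Veronese.config s d) I))) := by
  open Veronese in
  refine ⟨delta_le_iff.2 fun u hu => ?_, fun hsq =>
    (isMonomialIdeal_initialIdeal _ _).isSquarefreeIdeal fun u hu => ?_⟩
  · by_cases hmin : IsFibreMinimal m (config s d) u
    · obtain ⟨b, hb, hbu⟩ := exists_minimalExponents_le (hmin.monomial_imageExponent_mem hw hu.1)
      obtain ⟨v, hvu, hvb, hbv⟩ := exists_le_imageExponent _ u b hbu
      have huv : u ≤ v :=
        hu.2 (monomial_mem_initialIdeal_contraction hI (monomial_mem_of_le hbv hb.1)) hvu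
      exact le_max_of_le_right
        ((Finsupp.degree_mono huv).trans (hvb.trans (degree_le_delta hb)))
    · exact le_max_of_le_left (squarefree_quadratic_of_mem_minimalExponents hm hu hmin).2.le
  · by_cases hmin : IsFibreMinimal m (config s d) u
    · obtain ⟨G, hG, hspan⟩ := hsq
      have hmem := hmin.monomial_imageExponent_mem hw hu.1
      rw [hspan, monomial_mem_span_iff] at hmem
      obtain ⟨b, hb, hbu⟩ := hmem
      have hbw : monomial b (1 : K) ∈ weightInitialIdeal w I := by
        rw [hspan, monomial_mem_span_iff]
        exact ⟨b, hb, le_rfl⟩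
      intro j
      by_contra hj
      obtain ⟨v, rfl⟩ : ∃ v, u = v + Finsupp.single j 2 := by
        obtain ⟨v, hv⟩ := exists_add_of_le (Finsupp.single_le_iff.2 (by omega : 2 ≤ u j))
        exact ⟨v, hv.trans (add_comm _ _)⟩
      -- Dropping one of two copies of `x_j` still covers `b`, so a proper divisor of `x^u` lies in
      -- the ideal.
      have hle := hu.2 (monomial_mem_initialIdeal_contraction hI
        (monomial_mem_of_le ((hG b hb).le_imageExponent hbu) hbw))
        (add_le_add_right (Finsupp.single_mono one_le_two) v) j
      simp at hle
    · exact (squarefree_quadratic_of_mem_minimalExponents hm hu hmin).1
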